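/- **Theorem.** Let $X=\mathbb{F}^n$ with $\mathbb{F}=\mathbb{R}$ or $\mathbb{C}$ and $n\ge 0$, with its standard inner product, and let $G(X)$ be the full Grassmannian, the set of all linear subspaces of $X$ (of any dimension, including $\{0\}$). Give the exterior algebra $\bigwedge X$ the inner product for which distinct $\bigwedge^p X$ are orthogonal, $\langle v_1\wedge\cdots\wedge v_p,\,w_1\wedge\cdots\wedge w_p\rangle=\det(\langle v_i,w_j\rangle)$, and $\langle\kappa,\lambda\rangle=\bar\kappa\lambda$ for scalars. A $p$-blade is a multivector $A=v_1\wedge\cdots\wedge v_p$ (a scalar if $p=0$); a nonzero blade $A$ represents the subspace $\operatorname{span}\{v_1,\dots,v_p\}$ ($\{0\}$ if $p=0$). Let $P_W:\bigwedge X\to\bigwedge W$ be the orthogonal projection. For $V,W\in G(X)$ let $$\Theta_{V,W}=\arccos\frac{\|P_W A\|}{\|A\|},$$ where $A$ is a blade representing $V$. Then: 1. $\Theta_{V,W}$ does not depend on the choice of the blade $A$ representing $V$, and $\Theta_{V,W}\in[0,\frac{\pi}{2}]$. 2. $\Theta$ is an asymmetric metric on $G(X)$: for all $U,V,W\in G(X)$,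 $\Theta_{V,W}=\Theta_{W,V}=0$ if and only if $V=W$, and $\Theta_{U,W}\le\Theta_{U,V}+\Theta_{V,W}$. 3. For each $p\ge 0$, on the Grassmannian $G_p(X)$ of $p$-dimensional subspaces of $X$, $\Theta$ equals the Fubini–Study distance $$d_{FS}(V,W)=\arccos\frac{|\langle A,B\rangle|}{\|A\|\,\|B\|},\qquad 0\neq A\in\textstyle\bigwedge^p V,\quad 0\neq B\in\bigwedge^p W,$$ and $d_{FS}$ is a metric on $G_p(X)$. -/

import Mathlib

open scoped ENNReal

namespace AsymGrassmannian

noncomputable section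

/-- The space `X = 𝕜ⁿ`, where `𝕜` is `ℝ` or `ℂ`, with its standard inner product
(conjugate linear in the left entry). -/
abbrev X (𝕜 : Type*) [RCLike 𝕜] (n : ℕ) : Type _ := EuclideanSpace 𝕜 (Fin n)

/-- The Grassmann algebra `⋀ X` of multivectors. -/
abbrev Multivec (𝕜 : Type*) [RCLike 𝕜] (n : ℕ) : Type _ := ExteriorAlgebra 𝕜 (X 𝕜 n)

variable {𝕜 : Type*} [RCLike 𝕜] {n : ℕ}

/-- The canonical basis of `𝕜ⁿ`. -/
abbrev stdBasis (𝕜 : Type*) [RCLike 𝕜] (n : ℕ) : Module.Basis (Fin n) 𝕜 (X 𝕜 n) :=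
  (EuclideanSpace.basisFun (Fin n) 𝕜).toBasis

/-- The basis of `⋀ X` formed by the exterior products `e_{i₁} ∧ ⋯ ∧ e_{iₚ}`, `i₁ < ⋯ < iₚ`,
`0 ≤ p ≤ n`, of the canonical basis vectors of `X`. -/
abbrev bladeBasis (𝕜 : Type*) [RCLike 𝕜] (n : ℕ) :
    Module.Basis (Finset (Fin n)) 𝕜 (Multivec 𝕜 n) :=
  (stdBasis 𝕜 n).ExteriorAlgebra

/-! ### The inner product of multivectors

It is introduced by declaring `bladeBasis` orthonormal. `inner_wedge_wedge` and
`inner_eq_zero_of_grade_ne` below show that this is the usual inner product: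
`⟪v₁ ∧ ⋯ ∧ vₚ, w₁ ∧ ⋯ ∧ wₚ⟫ = det ⟪vᵢ, wⱼ⟫`, and multivectors of distinct grades are orthogonal. -/

/-- The standard inner product of `⋀ X`. -/
@[reducible] def multivecCore (𝕜 : Type*) [RCLike 𝕜] (n : ℕ) :
    InnerProductSpace.Core 𝕜 (Multivec 𝕜 n) where
  inner A B := ∑ s, starRingEnd 𝕜 ((bladeBasis 𝕜 n).repr A s) * (bladeBasis 𝕜 n).repr B s
  conj_inner_symm A B := by
    simp [map_sum, mul_comm]
  re_inner_nonneg A := by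
    rw [map_sum]
    refine Finset.sum_nonneg fun s _ => ?_
    rw [RCLike.conj_mul, ← RCLike.ofReal_pow, RCLike.ofReal_re]
    positivity
  add_left A B C := by
    simp [add_mul, Finset.sum_add_distrib]
  smul_left A B c := by
    simp [Finset.mul_sum, mul_assoc]
  definite A h := by
    have h' : ∑ s, ‖(bladeBasis 𝕜 n).repr A s‖ ^ 2 = 0 := by
      have h2 : ∑ s, starRingEnd 𝕜 ((bladeBasis 𝕜 n).repr A s) * (bladeBasis 𝕜 n).repr A s = 0 := h
      simp only [RCLike.conj_mul] at h2
      exact_mod_cast h2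
    rw [Finset.sum_eq_zero_iff_of_nonneg (fun _ _ => by positivity)] at h'
    apply (bladeBasis 𝕜 n).ext_elem
    intro s
    simpa using h' s (Finset.mem_univ s)

instance instNormedMultivec : NormedAddCommGroup (Multivec 𝕜 n) :=
  (multivecCore 𝕜 n).toNormedAddCommGroup

instance instInnerMultivec : InnerProductSpace 𝕜 (Multivec 𝕜 n) :=
  InnerProductSpace.ofCore (multivecCore 𝕜 n).toCore

instance instFiniteMultivec : FiniteDimensional 𝕜 (Multivec 𝕜 n) :=
  Module.Finite.of_basis (bladeBasis 𝕜 n)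

theorem inner_multivec (A B : Multivec 𝕜 n) :
    inner 𝕜 A B =
      ∑ s, starRingEnd 𝕜 ((bladeBasis 𝕜 n).repr A s) * (bladeBasis 𝕜 n).repr B s := rfl

theorem inner_bladeBasis (s t : Finset (Fin n)) :
    inner 𝕜 (bladeBasis 𝕜 n s) (bladeBasis 𝕜 n t) = if s = t then 1 else 0 := by
  rw [inner_multivec]
  simp [Finsupp.single_apply]

/-- Distinct `⋀ᵖ X` are orthogonal. -/
theorem inner_eq_zero_of_grade_ne {p q : ℕ} (hpq : p ≠ q) {A B : Multivec 𝕜 n}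
    (hA : A ∈ ⋀[𝕜]^p (X 𝕜 n)) (hB : B ∈ ⋀[𝕜]^q (X 𝕜 n)) : inner 𝕜 A B = 0 := by
  have h1 := ((stdBasis 𝕜 n).exteriorPower p).sum_repr ⟨A, hA⟩
  have h2 := ((stdBasis 𝕜 n).exteriorPower q).sum_repr ⟨B, hB⟩
  replace h1 := congrArg Subtype.val h1
  replace h2 := congrArg Subtype.val h2
  simp only [AddSubmonoidClass.coe_finsetSum, SetLike.val_smul,
    ← ExteriorAlgebra.basis_eq_coe_basis] at h1 h2
  rw [← h1, ← h2]
  simp only [sum_inner, inner_sum, inner_smul_left, inner_smul_right]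
  refine Finset.sum_eq_zero fun t _ =>
    mul_eq_zero_of_right _ (Finset.sum_eq_zero fun s _ => ?_)
  rw [inner_bladeBasis, if_neg]
  · simp
  · intro h
    apply hpq
    have hs := s.2
    have ht := t.2
    rw [Set.powersetCard.mem_iff] at hs ht
    rw [← hs, ← ht, h]

/-- The linear form `w₁ ∧ ⋯ ∧ wₚ ↦ det ⟪uᵢ, wⱼ⟫` on `⋀ᵖ X`. -/
def gramForm {p : ℕ} (u : Fin p → X 𝕜 n) : ⋀[𝕜]^p (X 𝕜 n) →ₗ[𝕜] 𝕜 :=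
  exteriorPower.pairingDual 𝕜 (X 𝕜 n) p
    (exteriorPower.ιMulti 𝕜 p fun i => (innerSL 𝕜 (u i) : X 𝕜 n →ₗ[𝕜] 𝕜))

theorem gramForm_wedge {p : ℕ} (u w : Fin p → X 𝕜 n) :
    gramForm u (exteriorPower.ιMulti 𝕜 p w) =
      (Matrix.of fun i j => inner 𝕜 (u i) (w j)).det := by
  rw [gramForm, exteriorPower.pairingDual_ιMulti_ιMulti, ← Matrix.det_transpose]
  rfl

theorem inner_bladeBasis_wedge {p : ℕ} (s : Set.powersetCard (Fin n) p) (w : Fin p → X 𝕜 n) :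
    inner 𝕜 (bladeBasis 𝕜 n s) (ExteriorAlgebra.ιMulti 𝕜 p w) =
      (Matrix.of fun i j =>
        inner 𝕜 (stdBasis 𝕜 n (Set.powersetCard.ofFinEmbEquiv.symm s i)) (w j)).det := by
  let L : ⋀[𝕜]^p (X 𝕜 n) →ₗ[𝕜] 𝕜 :=
    (innerSL 𝕜 (bladeBasis 𝕜 n s) : Multivec 𝕜 n →ₗ[𝕜] 𝕜) ∘ₗ (⋀[𝕜]^p (X 𝕜 n)).subtype
  have key : L = exteriorPower.ιMultiDual 𝕜 p (stdBasis 𝕜 n) s := by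
    apply ((stdBasis 𝕜 n).exteriorPower p).ext
    intro t
    have h1 : L ((stdBasis 𝕜 n).exteriorPower p t) =
        inner 𝕜 (bladeBasis 𝕜 n s) (bladeBasis 𝕜 n t) := by
      rw [bladeBasis, ExteriorAlgebra.basis_eq_coe_basis _ t]
      rfl
    rw [h1, inner_bladeBasis, exteriorPower.basis_apply]
    split_ifs with h
    · rw [← Subtype.ext h, exteriorPower.ιMultiDual_apply_diag]
    · rw [exteriorPower.ιMultiDual_apply_nondiag]
      intro h'
      exact h (congrArg Subtype.val h')
  have h := congrArg (fun F => F (exteriorPower.ιMulti 𝕜 p w)) key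
  have h3 : L (exteriorPower.ιMulti 𝕜 p w) =
      inner 𝕜 (bladeBasis 𝕜 n s) (ExteriorAlgebra.ιMulti 𝕜 p w) := rfl
  rw [← h3]
  refine h.trans ?_
  simp only [exteriorPower.ιMultiDual_apply_ιMulti]
  rw [← Matrix.det_transpose]
  congr 1
  ext i j
  simp [EuclideanSpace.inner_single_left]

/-- The inner product of two `p`-blades is the determinant of the inner products of
their factors. -/
theorem inner_wedge_wedge {p : ℕ} (v w : Fin p → X 𝕜 n) :
    inner 𝕜 (ExteriorAlgebra.ιMulti 𝕜 p v) (ExteriorAlgebra.ιMulti 𝕜 p w) =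
      (Matrix.of fun i j => inner 𝕜 (v i) (w j)).det := by
  let L : ⋀[𝕜]^p (X 𝕜 n) →ₗ[𝕜] 𝕜 :=
    (innerSL 𝕜 (ExteriorAlgebra.ιMulti 𝕜 p v) : Multivec 𝕜 n →ₗ[𝕜] 𝕜) ∘ₗ
      (⋀[𝕜]^p (X 𝕜 n)).subtype
  have key : L = gramForm v := by
    apply ((stdBasis 𝕜 n).exteriorPower p).ext
    intro t
    have h1 : L ((stdBasis 𝕜 n).exteriorPower p t) =
        inner 𝕜 (ExteriorAlgebra.ιMulti 𝕜 p v) (bladeBasis 𝕜 n t) := by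
      rw [bladeBasis, ExteriorAlgebra.basis_eq_coe_basis _ t]
      rfl
    rw [h1, exteriorPower.basis_apply, exteriorPower.ιMulti_family, gramForm_wedge,
      ← inner_conj_symm, inner_bladeBasis_wedge, RingHom.map_det, ← Matrix.det_transpose]
    congr 1
    ext i j
    simp only [Matrix.transpose_apply, RingHom.mapMatrix_apply, Matrix.map_apply,
      Matrix.of_apply, inner_conj_symm, Function.comp_apply]
  have h := congrArg (fun F => F (exteriorPower.ιMulti 𝕜 p w)) key
  refine Eq.trans ?_ (h.trans (gramForm_wedge v w))
  rfl

/-! ### Blades and projections -/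

/-- `Represents A V`: the multivector `A` is a nonzero blade, i.e. `A = c v₁ ∧ ⋯ ∧ vₚ` with `c` a
scalar (so that the `0`-blades are the scalars), and `V = span {v₁, …, vₚ}`. -/
def Represents (A : Multivec 𝕜 n) (V : Submodule 𝕜 (X 𝕜 n)) : Prop :=
  A ≠ 0 ∧ ∃ (p : ℕ) (c : 𝕜) (v : Fin p → X 𝕜 n),
    A = c • ExteriorAlgebra.ιMulti 𝕜 p v ∧ Submodule.span 𝕜 (Set.range v) = V

theorem exists_represents (V : Submodule 𝕜 (X 𝕜 n)) : ∃ A : Multivec 𝕜 n, Represents A V := by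
  let b := stdOrthonormalBasis 𝕜 V
  refine ⟨ExteriorAlgebra.ιMulti 𝕜 _ fun i => (b i : X 𝕜 n), ?_, _, 1, _,
    (one_smul _ _).symm, ?_⟩
  · intro h
    have h1 := inner_wedge_wedge (fun i => (b i : X 𝕜 n)) (fun i => (b i : X 𝕜 n))
    rw [h, inner_zero_left] at h1
    have h2 : (Matrix.of fun i j => inner 𝕜 (b i : X 𝕜 n) (b j : X 𝕜 n)) =
        (1 : Matrix _ _ 𝕜) := by
      ext i j
      have := orthonormal_iff_ite.mp b.orthonormal i j
      rw [Submodule.coe_inner] at this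
      simp [this, Matrix.one_apply]
    rw [h2, Matrix.det_one] at h1
    exact zero_ne_one h1
  · have h1 := b.toBasis.span_eq
    have h2 := congrArg (Submodule.map V.subtype) h1
    rw [Submodule.map_span, Submodule.map_top, Submodule.range_subtype, ← Set.range_comp] at h2
    refine Eq.trans ?_ h2
    congr 2

/-- `⋀ W` as a subspace of `⋀ X`. -/
def subAlg (W : Submodule 𝕜 (X 𝕜 n)) : Submodule 𝕜 (Multivec 𝕜 n) :=
  LinearMap.range (ExteriorAlgebra.map W.subtype).toLinearMap

/-- `P_W A`, the orthogonal projection of a multivector `A ∈ ⋀ X` onto `⋀ W`. -/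
def proj (W : Submodule 𝕜 (X 𝕜 n)) (A : Multivec 𝕜 n) : Multivec 𝕜 n :=
  (subAlg W).starProjection A

/-- A choice of a blade representing `V`. -/
def blade (V : Submodule 𝕜 (X 𝕜 n)) : Multivec 𝕜 n := (exists_represents V).choose

theorem blade_represents (V : Submodule 𝕜 (X 𝕜 n)) : Represents (blade V) V :=
  (exists_represents V).choose_spec

/-- The asymmetric angle `Θ_{V,W}`. -/
def asymAngle (V W : Submodule 𝕜 (X 𝕜 n)) : ℝ :=
  Real.arccos (‖proj W (blade V)‖ / ‖blade V‖)

/-! ### The Fubini–Study metric -/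

/-- The Hermitian angle `γ_{v,w}` of nonzero vectors. -/
def hermitianAngle {E : Type*} [NormedAddCommGroup E] [InnerProductSpace 𝕜 E] (v w : E) : ℝ :=
  Real.arccos (‖(inner 𝕜 v w : 𝕜)‖ / (‖v‖ * ‖w‖))

/-- The Fubini–Study distance of two lines of `⋀ X`. -/
def lineDist (K L : Projectivization 𝕜 (Multivec 𝕜 n)) : ℝ :=
  hermitianAngle (𝕜 := 𝕜) K.rep L.rep

/-- It can be computed with any vectors spanning the lines. -/
theorem lineDist_mk (A B : Multivec 𝕜 n) (hA : A ≠ 0) (hB : B ≠ 0) :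
    lineDist (Projectivization.mk 𝕜 A hA) (Projectivization.mk 𝕜 B hB) =
      hermitianAngle (𝕜 := 𝕜) A B := by
  obtain ⟨a, ha⟩ := Projectivization.exists_smul_eq_mk_rep 𝕜 A hA
  obtain ⟨b, hb⟩ := Projectivization.exists_smul_eq_mk_rep 𝕜 B hB
  rw [lineDist, ← ha, ← hb, hermitianAngle, hermitianAngle]
  congr 1
  have ha0 : ‖(a : 𝕜)‖ ≠ 0 := norm_ne_zero_iff.mpr a.ne_zero
  have hb0 : ‖(b : 𝕜)‖ ≠ 0 := norm_ne_zero_iff.mpr b.ne_zero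
  have hA0 : ‖A‖ ≠ 0 := norm_ne_zero_iff.mpr hA
  have hB0 : ‖B‖ ≠ 0 := norm_ne_zero_iff.mpr hB
  simp only [Units.smul_def, inner_smul_left, inner_smul_right, norm_mul, norm_smul,
    RCLike.norm_conj]
  field_simp

/-- The line `⋀ᵖ V ⊂ ⋀ X`, where `p = dim V`. -/
def topPower (V : Submodule 𝕜 (X 𝕜 n)) : Submodule 𝕜 (Multivec 𝕜 n) :=
  (⋀[𝕜]^(Module.finrank 𝕜 V) V).map (ExteriorAlgebra.map V.subtype).toLinearMap

theorem finrank_topPower (V : Submodule 𝕜 (X 𝕜 n)) : Module.finrank 𝕜 (topPower V) = 1 := by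
  have hinj : Function.Injective (ExteriorAlgebra.map V.subtype).toLinearMap :=
    ExteriorAlgebra.map_injective_field V.ker_subtype
  rw [topPower, ← (Submodule.equivMapOfInjective _ hinj _).finrank_eq, exteriorPower.finrank_eq,
    Nat.choose_self]

/-- The Plücker embedding `V ↦ ⋀ᵖ V`, `p = dim V`. -/
def plucker (V : Submodule 𝕜 (X 𝕜 n)) : Projectivization 𝕜 (Multivec 𝕜 n) :=
  Projectivization.mk'' (topPower V) (finrank_topPower V)

/-- The Grassmannian `G_p(X)` of `p`-dimensional subspaces of `X`. -/
abbrev Gr (𝕜 : Type*) [RCLike 𝕜] (n p : ℕ) : Type _ :=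
  {V : Submodule 𝕜 (X 𝕜 n) // Module.finrank 𝕜 V = p}

/-- The Fubini–Study distance `d_FS(V, W) = θ_{⋀ᵖ V, ⋀ᵖ W}` on `G_p(X)`. -/
def fubiniStudy {p : ℕ} (V W : Gr 𝕜 n p) : ℝ :=
  lineDist (plucker V.1) (plucker W.1)

end

/-! ### Asymmetric metrics -/

/-- An asymmetric metric on a non-empty set `M`. -/
structure IsAsymmetricMetric {M : Type*} (d : M → M → ℝ≥0∞) : Prop where
  nonempty : Nonempty M
  separation : ∀ x y, (d x y = 0 ∧ d y x = 0) ↔ x = y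
  triangle : ∀ x y z, d x z ≤ d x y + d y z

end AsymGrassmannian

namespace AsymGrassmannian

noncomputable section

variable {𝕜 : Type*} [RCLike 𝕜] {n : ℕ}

/-! ### Hermitian angles -/

/-! Everything rests on one fact: `P_W (v₁ ∧ ⋯ ∧ vₚ) = P_W v₁ ∧ ⋯ ∧ P_W vₚ`, so a projected blade is
zero or again a blade, representing a subspace of `W` (`proj_ιMulti`). Blades representing `V` span
the line `⋀ᵖ V`, so the ratio `‖P_W A‖ / ‖A‖` depends only on `V` and `W`. By Hadamard's inequality
this ratio can only decrease as `V` grows (`cosAngle_antitone`).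

For the triangle inequality, let `A` represent `U`, and put `B = P_V A`, `C = P_W B`. Hermitian
angles satisfy the triangle inequality; the angle of `A, B` is `Θ_{U,V}`; that of `B, C` is at most
`Θ_{V,W}` by monotonicity, as `B` represents a subspace of `V`; that of `A, C` is at least `Θ_{U,W}`
by Cauchy–Schwarz. Monotonicity also gives separation: if `Θ_{V,W} = 0`, every line of `V` lies in
`W`. In equal dimensions `P_W A` lies on the line `⋀ᵖ W`, and the ratio becomes the Fubini–Study
cosine. -/

theorem hermitianAngle_comm {E : Type*} [NormedAddCommGroup E] [InnerProductSpace 𝕜 E] (x y : E) :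
    hermitianAngle (𝕜 := 𝕜) x y = hermitianAngle (𝕜 := 𝕜) y x := by
  rw [hermitianAngle, hermitianAngle, norm_inner_symm, mul_comm ‖x‖]

theorem exists_norm_eq_one_inner_smul {E : Type*} [NormedAddCommGroup E] [InnerProductSpace 𝕜 E]
    (x y : E) : ∃ c : 𝕜, ‖c‖ = 1 ∧ inner 𝕜 y (c • x) = (‖(inner 𝕜 x y : 𝕜)‖ : 𝕜) := by
  obtain ⟨c, hc, h⟩ := RCLike.exists_norm_eq_mul_self (inner 𝕜 y x : 𝕜)
  exact ⟨c, hc, by rw [inner_smul_right, ← h, norm_inner_symm]⟩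

/-- Unit scalars rotate `x` and `z` until their inner products with `y` are real and nonnegative.
The two angles at `y` are then real angles, while the real angle between the rotated `x` and `z`
dominates the Hermitian one because `re ≤ ‖·‖`. -/
theorem hermitianAngle_triangle {E : Type*} [NormedAddCommGroup E] [InnerProductSpace 𝕜 E]
    (x y z : E) : hermitianAngle (𝕜 := 𝕜) x z ≤
      hermitianAngle (𝕜 := 𝕜) x y + hermitianAngle (𝕜 := 𝕜) y z := by
  obtain ⟨a, ha, hxy⟩ := exists_norm_eq_one_inner_smul (𝕜 := 𝕜) x y
  obtain ⟨b, hb, hyz⟩ := exists_norm_eq_one_inner_smul (𝕜 := 𝕜) z y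
  let _ : InnerProductSpace ℝ E := InnerProductSpace.rclikeToReal 𝕜 E
  have key := InnerProductGeometry.angle_le_angle_add_angle (a • x) y (b • z)
  have h1 : InnerProductGeometry.angle (a • x) y = hermitianAngle (𝕜 := 𝕜) x y := by
    rw [InnerProductGeometry.angle, hermitianAngle, real_inner_comm,
      real_inner_eq_re_inner 𝕜, hxy, RCLike.ofReal_re, norm_smul, ha, one_mul]
  have h2 : InnerProductGeometry.angle y (b • z) = hermitianAngle (𝕜 := 𝕜) y z := by
    rw [InnerProductGeometry.angle, hermitianAngle,
      real_inner_eq_re_inner 𝕜, hyz, RCLike.ofReal_re, norm_smul, hb, one_mul, norm_inner_symm]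
  have h3 : hermitianAngle (𝕜 := 𝕜) x z ≤ InnerProductGeometry.angle (a • x) (b • z) := by
    rw [InnerProductGeometry.angle, hermitianAngle,
      real_inner_eq_re_inner 𝕜, norm_smul, norm_smul, ha, hb, one_mul, one_mul]
    apply Real.arccos_le_arccos
    gcongr
    refine (RCLike.re_le_norm _).trans ?_
    rw [inner_smul_left, inner_smul_right, norm_mul, norm_mul, RCLike.norm_conj, ha, hb,
      one_mul, one_mul]
  rw [h1, h2] at key
  exact h3.trans key

/-! ### Projections of blades -/

theorem subAlg_eq_span (W : Submodule 𝕜 (X 𝕜 n)) :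
    subAlg W = Submodule.span 𝕜 (Set.range fun x : Σ p, (Fin p → W) =>
      ExteriorAlgebra.ιMulti 𝕜 x.1 (fun i => (x.2 i : X 𝕜 n))) := by
  rw [subAlg, LinearMap.range_eq_map, ← ExteriorAlgebra.ιMulti_span, Submodule.map_span,
    ← Set.range_comp]
  congr 2
  ext x
  simp [Function.comp_def]

theorem ιMulti_mem (p : ℕ) (v : Fin p → X 𝕜 n) :
    ExteriorAlgebra.ιMulti 𝕜 p v ∈ ⋀[𝕜]^p (X 𝕜 n) :=
  ExteriorAlgebra.ιMulti_range 𝕜 p ⟨v, rfl⟩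

/-- The projection of a blade is the exterior product of the projections of its factors. -/
theorem proj_ιMulti (W : Submodule 𝕜 (X 𝕜 n)) {p : ℕ} (v : Fin p → X 𝕜 n) :
    proj W (ExteriorAlgebra.ιMulti 𝕜 p v) =
      ExteriorAlgebra.ιMulti 𝕜 p fun i => W.starProjection (v i) := by
  refine Submodule.eq_starProjection_of_mem_of_inner_eq_zero (K := subAlg W) ?_ fun B hB => ?_
  · rw [subAlg_eq_span]
    exact Submodule.subset_span ⟨⟨p, fun i => W.orthogonalProjectionOnto (v i)⟩, rfl⟩
  · rw [subAlg_eq_span] at hB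
    induction hB using Submodule.span_induction with
    | zero => rw [inner_zero_right]
    | add _ _ _ _ h1 h2 => rw [inner_add_right, h1, h2, add_zero]
    | smul c _ _ h => rw [inner_smul_right, h, mul_zero]
    | mem B hB =>
      obtain ⟨⟨q, w⟩, rfl⟩ := hB
      rw [inner_sub_left, sub_eq_zero]
      by_cases hpq : p = q
      · subst hpq
        -- The two Gram matrices agree entrywise, since each `w j` lies in `W`.
        simp only [inner_wedge_wedge]
        congr 1
        ext i j
        simp only [Matrix.of_apply]
        rw [Submodule.inner_starProjection_left_eq_right,
          Submodule.starProjection_eq_self_iff.mpr (w j).2]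
      · rw [inner_eq_zero_of_grade_ne hpq (ιMulti_mem p _) (ιMulti_mem q _),
          inner_eq_zero_of_grade_ne hpq (ιMulti_mem p _) (ιMulti_mem q _)]

theorem proj_smul (W : Submodule 𝕜 (X 𝕜 n)) (c : 𝕜) (A : Multivec 𝕜 n) :
    proj W (c • A) = c • proj W A :=
  map_smul _ _ _

theorem inner_proj_left (W : Submodule 𝕜 (X 𝕜 n)) (A B : Multivec 𝕜 n) :
    inner 𝕜 (proj W A) B = inner 𝕜 A (proj W B) :=
  Submodule.inner_starProjection_left_eq_right _ _ _

theorem proj_proj (W : Submodule 𝕜 (X 𝕜 n)) (A : Multivec 𝕜 n) :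
    proj W (proj W A) = proj W A :=
  Submodule.starProjection_eq_self_iff.mpr (Submodule.starProjection_apply_mem _ _)

theorem inner_proj_self (W : Submodule 𝕜 (X 𝕜 n)) (A : Multivec 𝕜 n) :
    inner 𝕜 A (proj W A) = (‖proj W A‖ : 𝕜) ^ 2 := by
  rw [← inner_self_eq_norm_sq_to_K (𝕜 := 𝕜) (proj W A), inner_proj_left, proj_proj]

theorem proj_ιMulti_of_mem {W : Submodule 𝕜 (X 𝕜 n)} {p : ℕ} {v : Fin p → X 𝕜 n}
    (hv : ∀ i, v i ∈ W) :
    proj W (ExteriorAlgebra.ιMulti 𝕜 p v) = ExteriorAlgebra.ιMulti 𝕜 p v := by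
  rw [proj_ιMulti]
  congr 1
  ext1 i
  exact Submodule.starProjection_eq_self_iff.mpr (hv i)

theorem Represents.proj_self {A : Multivec 𝕜 n} {V : Submodule 𝕜 (X 𝕜 n)}
    (hA : Represents A V) : proj V A = A := by
  obtain ⟨-, p, c, v, rfl, rfl⟩ := hA
  rw [proj_smul, proj_ιMulti_of_mem fun i => Submodule.subset_span (Set.mem_range_self i)]

/-! ### Blades representing a subspace -/

theorem linearIndependent_of_ιMulti_ne_zero {p : ℕ} {v : Fin p → X 𝕜 n}
    (hv : ExteriorAlgebra.ιMulti 𝕜 p v ≠ 0) : LinearIndependent 𝕜 v := by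
  by_contra h
  exact hv (AlternatingMap.map_linearDependent _ _ h)

theorem smul_ιMulti_mem_topPower {V : Submodule 𝕜 (X 𝕜 n)} {p : ℕ} (c : 𝕜)
    {v : Fin p → X 𝕜 n} (hv : ∀ i, v i ∈ V) (hp : Module.finrank 𝕜 V = p) :
    c • ExteriorAlgebra.ιMulti 𝕜 p v ∈ topPower V := by
  subst hp
  refine Submodule.smul_mem _ _ ⟨ExteriorAlgebra.ιMulti 𝕜 _ fun i => ⟨v i, hv i⟩,
    ExteriorAlgebra.ιMulti_range 𝕜 _ ⟨_, rfl⟩, ?_⟩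
  simp only [AlgHom.toLinearMap_apply, ExteriorAlgebra.map_apply_ιMulti]
  rfl

/-- The number of factors of a blade is the dimension of the subspace it represents. -/
theorem Represents.exists_finrank {A : Multivec 𝕜 n} {V : Submodule 𝕜 (X 𝕜 n)}
    (hA : Represents A V) : ∃ (c : 𝕜) (v : Fin (Module.finrank 𝕜 V) → X 𝕜 n),
      A = c • ExteriorAlgebra.ιMulti 𝕜 _ v ∧ Submodule.span 𝕜 (Set.range v) = V := by
  obtain ⟨h0, p, c, v, rfl, rfl⟩ := hA
  have hv := linearIndependent_of_ιMulti_ne_zero (right_ne_zero_of_smul h0)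
  have hp := finrank_span_eq_card hv
  rw [Fintype.card_fin] at hp
  -- The dimension is generalized to a variable `q`, so that the equation with `p` can be
  -- substituted in the type `Fin q`.
  have h : ∀ q, q = p → ∃ (c' : 𝕜) (w : Fin q → X 𝕜 n),
      c • ExteriorAlgebra.ιMulti 𝕜 p v = c' • ExteriorAlgebra.ιMulti 𝕜 _ w ∧
      Submodule.span 𝕜 (Set.range w) = Submodule.span 𝕜 (Set.range v) := by
    rintro q rfl
    exact ⟨c, v, rfl, rfl⟩
  exact h _ hp

theorem Represents.mem_topPower {A : Multivec 𝕜 n} {V : Submodule 𝕜 (X 𝕜 n)}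
    (hA : Represents A V) : A ∈ topPower V := by
  obtain ⟨c, v, rfl, h⟩ := hA.exists_finrank
  exact smul_ιMulti_mem_topPower c (fun i => h ▸ Submodule.subset_span ⟨i, rfl⟩) rfl

theorem Represents.topPower_eq {A : Multivec 𝕜 n} {V : Submodule 𝕜 (X 𝕜 n)}
    (hA : Represents A V) : topPower V = Submodule.span 𝕜 {A} := by
  refine (Submodule.eq_of_le_of_finrank_eq
    ((Submodule.span_singleton_le_iff_mem _ _).mpr hA.mem_topPower) ?_).symm
  rw [finrank_topPower, finrank_span_singleton hA.1]

/-- The ratio `‖P_W A‖ / ‖A‖` for a blade `A` representing `V`. -/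
def cosAngle (V W : Submodule 𝕜 (X 𝕜 n)) : ℝ := ‖proj W (blade V)‖ / ‖blade V‖

/-- Two blades representing `V` differ by a nonzero scalar, which cancels in the ratio. -/
theorem Represents.cosAngle_eq {A : Multivec 𝕜 n} {V : Submodule 𝕜 (X 𝕜 n)}
    (hA : Represents A V) (W : Submodule 𝕜 (X 𝕜 n)) :
    cosAngle V W = ‖proj W A‖ / ‖A‖ := by
  have h := (blade_represents V).mem_topPower
  rw [hA.topPower_eq, Submodule.mem_span_singleton] at h
  obtain ⟨c, hc⟩ := h
  have hc0 : ‖c‖ ≠ 0 := by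
    rw [norm_ne_zero_iff]
    rintro rfl
    exact (blade_represents V).1 (by rw [← hc, zero_smul])
  rw [cosAngle, ← hc, proj_smul, norm_smul, norm_smul, mul_div_mul_left _ _ hc0]

theorem cosAngle_nonneg (V W : Submodule 𝕜 (X 𝕜 n)) : 0 ≤ cosAngle V W := by
  unfold cosAngle
  positivity

theorem cosAngle_self (V : Submodule 𝕜 (X 𝕜 n)) : cosAngle V V = 1 := by
  rw [cosAngle, (blade_represents V).proj_self,
    div_self (norm_ne_zero_iff.mpr (blade_represents V).1)]

/-! ### Monotonicity in the first subspace -/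

theorem ιMulti_cons {p : ℕ} (x : X 𝕜 n) (v : Fin p → X 𝕜 n) :
    ExteriorAlgebra.ιMulti 𝕜 (p + 1) (Fin.cons x v : Fin (p + 1) → X 𝕜 n) =
      ExteriorAlgebra.ι 𝕜 x * ExteriorAlgebra.ιMulti 𝕜 p v := by
  rw [ExteriorAlgebra.ιMulti_succ_apply]
  rfl

theorem ι_mul_ιMulti_eq_zero {p : ℕ} {x : X 𝕜 n} {v : Fin p → X 𝕜 n}
    (hx : x ∈ Submodule.span 𝕜 (Set.range v)) :
    ExteriorAlgebra.ι 𝕜 x * ExteriorAlgebra.ιMulti 𝕜 p v = 0 := by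
  rw [← ιMulti_cons]
  refine AlternatingMap.map_linearDependent _ _ fun h => ?_
  exact (linearIndependent_finCons.mp h).2 hx

/-- The first row of the Gram matrix vanishes off its first entry `‖x‖²`, so the determinant
factors. -/
theorem norm_ι_mul_ιMulti_of_orthogonal {p : ℕ} {x : X 𝕜 n} {v : Fin p → X 𝕜 n}
    (hx : x ∈ (Submodule.span 𝕜 (Set.range v))ᗮ) :
    ‖ExteriorAlgebra.ι 𝕜 x * ExteriorAlgebra.ιMulti 𝕜 p v‖ =
      ‖x‖ * ‖ExteriorAlgebra.ιMulti 𝕜 p v‖ := by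
  rw [← ιMulti_cons, ← sq_eq_sq₀ (norm_nonneg _) (by positivity)]
  have h : ((‖ExteriorAlgebra.ιMulti 𝕜 (p + 1) (Fin.cons x v : Fin (p + 1) → X 𝕜 n)‖ ^ 2 : ℝ) : 𝕜)
      = (((‖x‖ * ‖ExteriorAlgebra.ιMulti 𝕜 p v‖) ^ 2 : ℝ) : 𝕜) := by
    rw [mul_pow]
    push_cast
    rw [← inner_self_eq_norm_sq_to_K, ← inner_self_eq_norm_sq_to_K, ← inner_self_eq_norm_sq_to_K,
      inner_wedge_wedge, inner_wedge_wedge, Matrix.det_succ_row_zero, Fin.sum_univ_succ,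
      Finset.sum_eq_zero, add_zero]
    · simp only [Fin.val_zero, pow_zero, one_mul, Matrix.of_apply, Fin.cons_zero,
        Fin.succAbove_zero]
      rfl
    · intro j _
      rw [Matrix.of_apply, Fin.cons_zero, Fin.cons_succ, Submodule.inner_left_of_mem_orthogonal
        (Submodule.subset_span (Set.mem_range_self j)) hx, mul_zero, zero_mul]
  exact_mod_cast h

theorem ι_mul_ιMulti_eq_orthogonal {p : ℕ} (x : X 𝕜 n) (v : Fin p → X 𝕜 n) :
    ExteriorAlgebra.ι 𝕜 x * ExteriorAlgebra.ιMulti 𝕜 p v =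
      ExteriorAlgebra.ι 𝕜 (x - (Submodule.span 𝕜 (Set.range v)).starProjection x) *
        ExteriorAlgebra.ιMulti 𝕜 p v := by
  rw [map_sub, sub_mul, ι_mul_ιMulti_eq_zero
    (x := (Submodule.span 𝕜 (Set.range v)).starProjection x)
    (Submodule.starProjection_apply_mem _ _), sub_zero]

/-- Hadamard's inequality for one vector. -/
theorem norm_ι_mul_ιMulti_le {p : ℕ} (x : X 𝕜 n) (v : Fin p → X 𝕜 n) :
    ‖ExteriorAlgebra.ι 𝕜 x * ExteriorAlgebra.ιMulti 𝕜 p v‖ ≤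
      ‖x‖ * ‖ExteriorAlgebra.ιMulti 𝕜 p v‖ := by
  rw [ι_mul_ιMulti_eq_orthogonal,
    norm_ι_mul_ιMulti_of_orthogonal (Submodule.sub_starProjection_mem_orthogonal _)]
  gcongr
  rw [← Submodule.starProjection_orthogonal_val]
  exact Submodule.norm_starProjection_apply_le _ _

/-- Only the component `y` of `x` orthogonal to `V` matters. Wedging with `y` multiplies the
denominator by exactly `‖y‖`, and the numerator by at most `‖P_W y‖ ≤ ‖y‖`. -/
theorem cosAngle_sup_span_singleton_le (V W : Submodule 𝕜 (X 𝕜 n)) (x : X 𝕜 n) :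
    cosAngle (V ⊔ Submodule.span 𝕜 {x}) W ≤ cosAngle V W := by
  by_cases hx : x ∈ V
  · rw [sup_eq_left.mpr ((Submodule.span_singleton_le_iff_mem _ _).mpr hx)]
  obtain ⟨h0, p, c, v, hA, rfl⟩ := blade_represents V
  rw [hA] at h0
  have hc := left_ne_zero_of_smul h0
  have hv := right_ne_zero_of_smul h0
  have hv' : 0 < ‖ExteriorAlgebra.ιMulti 𝕜 p v‖ := norm_pos_iff.mpr hv
  have hrep : Represents (ExteriorAlgebra.ιMulti 𝕜 p v) (Submodule.span 𝕜 (Set.range v)) :=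
    ⟨hv, p, 1, v, (one_smul _ _).symm, rfl⟩
  set y := x - (Submodule.span 𝕜 (Set.range v)).starProjection x with hy
  have hy0 : y ≠ 0 := by
    intro h
    rw [hy, sub_eq_zero] at h
    exact hx (h ▸ Submodule.starProjection_apply_mem _ _)
  have hnorm : ‖ExteriorAlgebra.ιMulti 𝕜 (p + 1) (Fin.cons y v : Fin (p + 1) → X 𝕜 n)‖ =
      ‖y‖ * ‖ExteriorAlgebra.ιMulti 𝕜 p v‖ := by
    rw [ιMulti_cons, norm_ι_mul_ιMulti_of_orthogonal
      (Submodule.sub_starProjection_mem_orthogonal _)]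
  have hrep' : Represents
      (ExteriorAlgebra.ιMulti 𝕜 (p + 1) (Fin.cons y v : Fin (p + 1) → X 𝕜 n))
      (Submodule.span 𝕜 (Set.range v) ⊔ Submodule.span 𝕜 {x}) := by
    -- The factors `x, v` give the same blade as `y, v`, and their span is immediate.
    refine ⟨?_, p + 1, 1, Fin.cons x v, ?_, ?_⟩
    · rw [← norm_ne_zero_iff, hnorm]
      exact mul_ne_zero (norm_ne_zero_iff.mpr hy0) hv'.ne'
    · rw [one_smul, ιMulti_cons, ιMulti_cons, ι_mul_ιMulti_eq_orthogonal x v]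
    · rw [Fin.range_cons, Submodule.span_insert, sup_comm]
  rw [hrep'.cosAngle_eq, hrep.cosAngle_eq, hnorm,
    div_le_div_iff₀ (mul_pos (norm_pos_iff.mpr hy0) hv') hv']
  have hproj : ‖proj W (ExteriorAlgebra.ιMulti 𝕜 (p + 1) (Fin.cons y v : Fin (p + 1) → X 𝕜 n))‖
      ≤ ‖y‖ * ‖proj W (ExteriorAlgebra.ιMulti 𝕜 p v)‖ := by
    have hcons : (fun i => W.starProjection ((Fin.cons y v : Fin (p + 1) → X 𝕜 n) i)) =
        (Fin.cons (W.starProjection y) fun i => W.starProjection (v i)) := by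
      ext1 i
      refine Fin.cases rfl (fun _ => rfl) i
    rw [proj_ιMulti, proj_ιMulti, hcons, ιMulti_cons]
    refine (norm_ι_mul_ιMulti_le _ _).trans ?_
    gcongr
    exact Submodule.norm_starProjection_apply_le _ _
  calc _ ≤ (‖y‖ * ‖proj W (ExteriorAlgebra.ιMulti 𝕜 p v)‖) * ‖ExteriorAlgebra.ιMulti 𝕜 p v‖ := by
        gcongr
    _ = _ := by ring

theorem cosAngle_antitone (W : Submodule 𝕜 (X 𝕜 n)) {V V' : Submodule 𝕜 (X 𝕜 n)} (h : V' ≤ V) :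
    cosAngle V W ≤ cosAngle V' W := by
  -- Adjoining `C` to an arbitrary `U` lets the induction on generators of `C` add one vector at a
  -- time.
  have key : ∀ C U : Submodule 𝕜 (X 𝕜 n), cosAngle (U ⊔ C) W ≤ cosAngle U W := by
    intro C
    refine Submodule.fg_induction (motive := fun C _ => ∀ U, cosAngle (U ⊔ C) W ≤ cosAngle U W)
      (fun x U => cosAngle_sup_span_singleton_le U W x) (fun C₁ C₂ _ _ h1 h2 U => ?_) C
      (IsNoetherian.noetherian C)
    rw [← sup_assoc]
    exact (h2 _).trans (h1 _)
  simpa [sup_eq_right.mpr h] using key V V'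

/-! ### The asymmetric metric -/

theorem asymAngle_eq_arccos (V W : Submodule 𝕜 (X 𝕜 n)) :
    asymAngle V W = Real.arccos (cosAngle V W) := rfl

theorem asymAngle_nonneg (V W : Submodule 𝕜 (X 𝕜 n)) : 0 ≤ asymAngle V W :=
  Real.arccos_nonneg _

theorem asymAngle_le_pi_div_two (V W : Submodule 𝕜 (X 𝕜 n)) : asymAngle V W ≤ Real.pi / 2 :=
  Real.arccos_le_pi_div_two.mpr (cosAngle_nonneg V W)

theorem asymAngle_self (V : Submodule 𝕜 (X 𝕜 n)) : asymAngle V V = 0 := by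
  rw [asymAngle_eq_arccos, cosAngle_self, Real.arccos_one]

theorem cosAngle_span_singleton {x : X 𝕜 n} (hx : x ≠ 0) (W : Submodule 𝕜 (X 𝕜 n)) :
    cosAngle (Submodule.span 𝕜 {x}) W = ‖W.starProjection x‖ / ‖x‖ := by
  have hnorm : ∀ y : X 𝕜 n, ‖ExteriorAlgebra.ιMulti 𝕜 1 fun _ => y‖ = ‖y‖ := by
    intro y
    have h := inner_wedge_wedge (p := 1) (fun _ => y) (fun _ => y)
    rw [Matrix.det_fin_one, Matrix.of_apply, inner_self_eq_norm_sq_to_K,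
      inner_self_eq_norm_sq_to_K] at h
    exact (sq_eq_sq₀ (norm_nonneg _) (norm_nonneg _)).mp (by exact_mod_cast h)
  have hrep : Represents (ExteriorAlgebra.ιMulti 𝕜 1 fun _ => x) (Submodule.span 𝕜 {x}) := by
    refine ⟨?_, 1, 1, fun _ => x, (one_smul _ _).symm, by rw [Set.range_const]⟩
    rw [← norm_ne_zero_iff, hnorm]
    exact norm_ne_zero_iff.mpr hx
  rw [hrep.cosAngle_eq, proj_ιMulti, hnorm, hnorm]

/-- By monotonicity each line of `V` also has cosine at least 1, so projection to `W` preserves the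
norm of its vectors. -/
theorem le_of_asymAngle_eq_zero {V W : Submodule 𝕜 (X 𝕜 n)} (h : asymAngle V W = 0) :
    V ≤ W := by
  intro x hx
  by_cases hx0 : x = 0
  · exact hx0 ▸ W.zero_mem
  have h1 : 1 ≤ cosAngle V W := Real.arccos_eq_zero.mp h
  have h2 := h1.trans (cosAngle_antitone W ((Submodule.span_singleton_le_iff_mem _ _).mpr hx))
  rw [cosAngle_span_singleton hx0, one_le_div (norm_pos_iff.mpr hx0)] at h2
  exact (Submodule.mem_iff_norm_starProjection W x).mpr
    (le_antisymm (Submodule.norm_starProjection_apply_le _ _) h2)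

theorem asymAngle_triangle (U V W : Submodule 𝕜 (X 𝕜 n)) :
    asymAngle U W ≤ asymAngle U V + asymAngle V W := by
  have hA := blade_represents U
  set A := blade U with hAdef
  have hA0 : ‖A‖ ≠ 0 := norm_ne_zero_iff.mpr hA.1
  -- If `B = 0` then `Θ_{U,V} = π/2`, already the largest possible value.
  by_cases hB : proj V A = 0
  · have h : asymAngle U V = Real.pi / 2 := by
      rw [asymAngle_eq_arccos, hA.cosAngle_eq, hB, norm_zero, zero_div, Real.arccos_zero]
    linarith [asymAngle_le_pi_div_two U W, asymAngle_nonneg V W]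
  set B := proj V A with hBdef
  have hB0 : ‖B‖ ≠ 0 := norm_ne_zero_iff.mpr hB
  obtain ⟨V', hV', hBrep⟩ : ∃ V' ≤ V, Represents B V' := by
    obtain ⟨-, p, c, v, hv, -⟩ := hA
    refine ⟨_, ?_, hB, p, c, _, by rw [hBdef, hv, proj_smul, proj_ιMulti], rfl⟩
    rw [Submodule.span_le]
    rintro _ ⟨i, rfl⟩
    exact Submodule.starProjection_apply_mem _ _
  have hle : cosAngle V W ≤ ‖proj W B‖ / ‖B‖ :=
    hBrep.cosAngle_eq W ▸ cosAngle_antitone W hV'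
  -- If `C = 0`, monotonicity forces `Θ_{V,W} = π/2`.
  by_cases hC : proj W B = 0
  · have h : Real.pi / 2 ≤ asymAngle V W := by
      rw [hC, norm_zero, zero_div] at hle
      rw [← Real.arccos_zero]
      exact Real.arccos_le_arccos hle
    linarith [asymAngle_le_pi_div_two U W, asymAngle_nonneg U V]
  have hC0 : 0 < ‖proj W B‖ := norm_pos_iff.mpr hC
  have hAB : hermitianAngle (𝕜 := 𝕜) A B = asymAngle U V := by
    rw [hermitianAngle, hBdef, inner_proj_self, ← hBdef, asymAngle_eq_arccos, hA.cosAngle_eq,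
      norm_pow, RCLike.norm_ofReal, abs_norm, sq, mul_div_mul_right _ _ hB0]
  have hBC : hermitianAngle (𝕜 := 𝕜) B (proj W B) ≤ asymAngle V W := by
    rw [hermitianAngle, inner_proj_self, norm_pow, RCLike.norm_ofReal, abs_norm, sq,
      mul_div_mul_right _ _ hC0.ne']
    exact Real.arccos_le_arccos hle
  have hAC : asymAngle U W ≤ hermitianAngle (𝕜 := 𝕜) A (proj W B) := by
    rw [hermitianAngle, asymAngle_eq_arccos, hA.cosAngle_eq]
    apply Real.arccos_le_arccos
    rw [← mul_div_mul_right ‖proj W A‖ ‖A‖ hC0.ne']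
    gcongr
    -- Cauchy–Schwarz is applied to `⟪P_W A, P_W B⟫ = ⟪A, P_W B⟫`.
    rw [← proj_proj W B, ← inner_proj_left, proj_proj]
    exact norm_inner_le_norm _ _
  linarith [hermitianAngle_triangle (𝕜 := 𝕜) A B (proj W B)]

theorem isAsymmetricMetric_asymAngle :
    IsAsymmetricMetric fun V W : Submodule 𝕜 (X 𝕜 n) => ENNReal.ofReal (asymAngle V W) where
  nonempty := ⟨⊥⟩
  separation V W := by
    constructor
    · rintro ⟨h1, h2⟩
      -- `ENNReal.ofReal` truncates negative values, so this gives only `≤ 0`; nonnegativity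
      -- supplies the rest.
      rw [ENNReal.ofReal_eq_zero] at h1 h2
      exact le_antisymm (le_of_asymAngle_eq_zero (le_antisymm h1 (asymAngle_nonneg _ _)))
        (le_of_asymAngle_eq_zero (le_antisymm h2 (asymAngle_nonneg _ _)))
    · rintro rfl
      simp [asymAngle_self]
  triangle U V W := by
    rw [← ENNReal.ofReal_add (asymAngle_nonneg _ _) (asymAngle_nonneg _ _)]
    exact ENNReal.ofReal_le_ofReal (asymAngle_triangle U V W)

/-! ### The Fubini–Study metric -/

theorem Represents.plucker_eq {A : Multivec 𝕜 n} {V : Submodule 𝕜 (X 𝕜 n)}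
    (hA : Represents A V) : plucker V = Projectivization.mk 𝕜 A hA.1 := by
  apply Projectivization.submodule_injective
  rw [plucker, Projectivization.submodule_mk'', Projectivization.submodule_mk, hA.topPower_eq]

theorem fubiniStudy_eq_hermitianAngle {p : ℕ} (V W : Gr 𝕜 n p) :
    fubiniStudy V W = hermitianAngle (𝕜 := 𝕜) (blade V.1) (blade W.1) := by
  rw [fubiniStudy, (blade_represents V.1).plucker_eq, (blade_represents W.1).plucker_eq,
    lineDist_mk]

/-- Since `P_W A` is a wedge of `p = dim W` vectors of `W`, it equals `c • B` with `B` representing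
`W`; hence `|⟪A, B⟫| = ‖P_W A‖ ‖B‖`. -/
theorem asymAngle_eq_fubiniStudy {p : ℕ} (V W : Gr 𝕜 n p) :
    asymAngle V.1 W.1 = fubiniStudy V W := by
  have hA := blade_represents V.1
  have hB := blade_represents W.1
  obtain ⟨c, hc⟩ : ∃ c : 𝕜, c • blade W.1 = proj W.1 (blade V.1) := by
    rw [← Submodule.mem_span_singleton, ← hB.topPower_eq]
    obtain ⟨a, v, hv, -⟩ := hA.exists_finrank
    rw [hv, proj_smul, proj_ιMulti]
    exact smul_ιMulti_mem_topPower a (fun i => Submodule.starProjection_apply_mem _ _)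
      (W.2.trans V.2.symm)
  have hB0 : ‖blade W.1‖ ≠ 0 := norm_ne_zero_iff.mpr hB.1
  rw [fubiniStudy_eq_hermitianAngle, hermitianAngle, asymAngle]
  congr 1
  have h : inner 𝕜 (blade V.1) (blade W.1) = starRingEnd 𝕜 c * (‖blade W.1‖ : 𝕜) ^ 2 := by
    conv_lhs => rw [← hB.proj_self, ← inner_proj_left, ← hc, inner_smul_left,
      inner_self_eq_norm_sq_to_K]
  rw [h, ← hc, norm_mul, norm_smul, RCLike.norm_conj, norm_pow, RCLike.norm_ofReal, abs_norm, sq,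
    ← mul_assoc, mul_div_mul_right _ _ hB0]

theorem fubiniStudy_comm {p : ℕ} (V W : Gr 𝕜 n p) : fubiniStudy V W = fubiniStudy W V :=
  hermitianAngle_comm _ _

/-- `G_p(X)` with the Fubini–Study distance. -/
@[reducible] def fubiniStudyMetricSpace (𝕜 : Type*) [RCLike 𝕜] (n p : ℕ) :
    MetricSpace (Gr 𝕜 n p) where
  dist := fubiniStudy
  dist_self V := by
    rw [← asymAngle_eq_fubiniStudy, asymAngle_self]
  dist_comm := fubiniStudy_comm
  dist_triangle U V W := by
    simp only [← asymAngle_eq_fubiniStudy]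
    exact asymAngle_triangle _ _ _
  eq_of_dist_eq_zero {V W} h := by
    have h1 : asymAngle V.1 W.1 = 0 := (asymAngle_eq_fubiniStudy V W).trans h
    have h2 : asymAngle W.1 V.1 = 0 :=
      (asymAngle_eq_fubiniStudy W V).trans ((fubiniStudy_comm W V).trans h)
    exact Subtype.ext (le_antisymm (le_of_asymAngle_eq_zero h1) (le_of_asymAngle_eq_zero h2))

end

end AsymGrassmannian

theorem mainTheorem1 (𝕜 : Type*) [RCLike 𝕜] (n : ℕ) :
    -- the angle does not depend on the blade chosen to represent `V`
    (∀ (V W : Submodule 𝕜 (AsymGrassmannian.X 𝕜 n)) (A : AsymGrassmannian.Multivec 𝕜 n),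
      AsymGrassmannian.Represents A V →
        AsymGrassmannian.asymAngle V W =
          Real.arccos (‖AsymGrassmannian.proj W A‖ / ‖A‖)) ∧
    -- it takes values in `[0, π/2]`
    (∀ V W : Submodule 𝕜 (AsymGrassmannian.X 𝕜 n),
      AsymGrassmannian.asymAngle V W ∈ Set.Icc 0 (Real.pi / 2)) ∧
    -- it is an asymmetric metric on the full Grassmannian
    AsymGrassmannian.IsAsymmetricMetric
      (fun V W : Submodule 𝕜 (AsymGrassmannian.X 𝕜 n) =>
        ENNReal.ofReal (AsymGrassmannian.asymAngle V W)) ∧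
    -- on each `G_p(X)` it is the Fubini–Study distance, which is a metric
    (∀ p : ℕ,
      (∀ V W : AsymGrassmannian.Gr 𝕜 n p,
        AsymGrassmannian.asymAngle V.1 W.1 = AsymGrassmannian.fubiniStudy V W) ∧
      ∃ m : MetricSpace (AsymGrassmannian.Gr 𝕜 n p),
        ∀ V W : AsymGrassmannian.Gr 𝕜 n p,
          m.dist V W = AsymGrassmannian.fubiniStudy V W) := by
  exact ⟨fun V W A hA => congrArg Real.arccos (hA.cosAngle_eq W),
    fun V W => ⟨AsymGrassmannian.asymAngle_nonneg V W, AsymGrassmannian.asymAngle_le_pi_div_two V W⟩,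
    AsymGrassmannian.isAsymmetricMetric_asymAngle,
    fun p => ⟨AsymGrassmannian.asymAngle_eq_fubiniStudy,
      AsymGrassmannian.fubiniStudyMetricSpace 𝕜 n p, fun _ _ => rfl⟩⟩
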